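/- Let $m$ be a positive integer and let $J\subseteq \mathbb{Z}_{2m+1}\setminus\{0\}$ satisfy $|J|=m$ and $|\{j,-j\}\cap J|=1$ for every $j\in J$. Let $\overrightarrow{C}_{2m+1}(J)$ be the circulant tournament with vertex set $\mathbb{Z}_{2m+1}$ (the residues modulo $2m+1$) and arc set $\{(i,j) : j-i\in J\}$. For digraphs $D$ and $F$, the composition $D[F]$ is the digraph obtained by replacing each vertex $v$ of $D$ by a copy $F_v$ of $F$ (the copies being pairwise disjoint) and adding all arcs from $V(F_v)$ to $V(F_w)$ whenever $(v,w)$ is an arc of $D$. A digraph is called simple if it is not isomorphic to a composition $D[F]$ of two digraphs $D$ and $F$ with at least two vertices each. For a nonempty subset $C$ of an abelian group $G$, the period of $C$ is $H(C)=\{g\in G : C+g=C\}$, and $C$ is called aperiodic if $H(C)=\{0\}$. Write $J+J=\{a+b : a,b\in J\}$. If $\overrightarrow{C}_{2m+1}(J)$ is simple, then both $J$ and $J+J$ are aperiodic subsets of $\mathbb{Z}_{2m+1}$. -/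

import Mathlib

open scoped Pointwise

/-- `J ⊆ ℤ/(2m+1) ∖ {0}` is the symbol set of a circulant tournament: `|J| = m` and `J` contains
exactly one element of `{j, -j}` for every `j ∈ J`. -/
structure IsSymbolSet (m : ℕ) (J : Set (ZMod (2 * m + 1))) : Prop where
  zero_notMem : (0 : ZMod (2 * m + 1)) ∉ J
  ncard_eq : J.ncard = m
  ncard_pair_inter : ∀ j ∈ J, (({j, -j} : Set (ZMod (2 * m + 1))) ∩ J).ncard = 1

/-- The circulant digraph on `ℤ/(2m+1)`, with an arc from `i` to `j` exactly when `j - i ∈ J`.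
It is the circulant tournament with symbol set `J` when `IsSymbolSet m J` holds. -/
def circulantTournament (m : ℕ) (J : Set (ZMod (2 * m + 1))) : Digraph (ZMod (2 * m + 1)) where
  Adj i j := j - i ∈ J

/-- The composition (lexicographic product) `D[F]`: every vertex `v` of `D` is replaced by the
copy `{v} × W` of `F`, and all arcs go from the copy at `v` to the copy at `w` when `(v, w)` is
an arc of `D`. -/
def digraphComposition {V W : Type*} (D : Digraph V) (F : Digraph W) : Digraph (V × W) where
  Adj x y := (x.1 = y.1 ∧ F.Adj x.2 y.2) ∨ D.Adj x.1 y.1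

/-- Two digraphs are isomorphic if some bijection of the vertices preserves and reflects arcs. -/
def DigraphIsomorphic {V W : Type*} (D : Digraph V) (F : Digraph W) : Prop :=
  Nonempty (D.Adj ≃r F.Adj)

/-- A digraph is simple (prime) if it is not isomorphic to a composition `D[F]` of two digraphs
with at least two vertices each (compositions with a one-vertex digraph are trivial). -/
def IsSimpleDigraph {U : Type} (G : Digraph U) : Prop :=
  ∀ (V W : Type) (D : Digraph V) (F : Digraph W), Nontrivial V → Nontrivial W →
    ¬ DigraphIsomorphic G (digraphComposition D F)

/-- The period `H(C) = {g : C + g = C}` of a subset `C` of an abelian group. -/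
def setPeriod {G : Type*} [AddCommGroup G] (C : Set G) : Set G :=
  {g | C + {g} = C}

/-- A subset of an abelian group is aperiodic if its period is `{0}`. -/
def IsAperiodicSet {G : Type*} [AddCommGroup G] (C : Set G) : Prop :=
  setPeriod C = {0}

/-! Let `H` be the period of `J + J`, a set that misses `0`. If `x ∈ J`, `h ∈ H` but `x + h` is
nonzero and outside `J`, then `-(x + h) ∈ J`, so `-h ∈ J + J` and, by periodicity, `0 ∈ J + J`.
Hence off `H` the set `J` is a union of `H`-cosets, and the tournament is a composition over the
quotient by `H`; simplicity forces `H` trivial. Aperiodicity of `J` needs only `0 ∉ J`. -/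

theorem IsSymbolSet.neg_notMem {m : ℕ} {J : Set (ZMod (2 * m + 1))} (hJ : IsSymbolSet m J)
    {j : ZMod (2 * m + 1)} (hj : j ∈ J) : -j ∉ J := by
  intro hnj
  have h := hJ.ncard_pair_inter j hj
  obtain ⟨a, ha⟩ := Set.ncard_eq_one.1 h
  have h₁ : j ∈ ({a} : Set (ZMod (2 * m + 1))) := ha ▸ ⟨Or.inl rfl, hj⟩
  have h₂ : -j ∈ ({a} : Set (ZMod (2 * m + 1))) := ha ▸ ⟨Or.inr rfl, hnj⟩
  have hneg : -j = j := h₂.trans h₁.symm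
  rcases (ZMod.neg_eq_self_iff j).1 hneg with h0 | h0
  · exact hJ.zero_notMem (h0 ▸ hj)
  · omega

/-- By counting: two disjoint sets of size `m` fill the `2m` nonzero residues. -/
theorem IsSymbolSet.union_neg_eq {m : ℕ} {J : Set (ZMod (2 * m + 1))} (hJ : IsSymbolSet m J) :
    J ∪ -J = {0}ᶜ := by
  have hdisj : Disjoint J (-J) :=
    Set.disjoint_left.2 fun _ hj hnj => hJ.neg_notMem hj hnj
  refine Set.eq_of_subset_of_ncard_le ?_ ?_ (Set.toFinite _)
  · rintro x (hx | hx) rfl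
    · exact hJ.zero_notMem hx
    · exact hJ.zero_notMem (by simpa using hx)
  · have hneg : (-J).ncard = J.ncard := by
      rw [← Set.image_neg_eq_neg, Set.ncard_image_of_injective _ neg_injective]
    rw [Set.ncard_union_eq hdisj (Set.toFinite _) (Set.toFinite _), hneg, hJ.ncard_eq,
      Set.ncard_compl, Set.ncard_singleton, Nat.card_eq_fintype_card, ZMod.card]
    omega

theorem IsSymbolSet.mem_or_neg_mem {m : ℕ} {J : Set (ZMod (2 * m + 1))} (hJ : IsSymbolSet m J)
    {x : ZMod (2 * m + 1)} (hx : x ≠ 0) : x ∈ J ∨ -x ∈ J := by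
  have : x ∈ J ∪ -J := hJ.union_neg_eq ▸ hx
  simpa using this

theorem zero_mem_setPeriod {G : Type*} [AddCommGroup G] (C : Set G) : (0 : G) ∈ setPeriod C := by
  simp [setPeriod]

theorem setPeriod_eq_stabilizer {G : Type*} [AddCommGroup G] (C : Set G) :
    setPeriod C = AddAction.stabilizer G C := by
  ext g
  simp only [setPeriod, Set.mem_ofPred_eq, SetLike.mem_coe, AddAction.mem_stabilizer_iff]
  rw [add_comm, ← Set.singleton_vadd, vadd_eq_add]

theorem neg_mem_setPeriod {G : Type*} [AddCommGroup G] {C : Set G} {g : G}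
    (hg : g ∈ setPeriod C) : -g ∈ setPeriod C := by
  rw [setPeriod_eq_stabilizer] at hg ⊢
  exact neg_mem hg

theorem add_mem_iff_of_mem_setPeriod {G : Type*} [AddCommGroup G] {C : Set G} {g : G}
    (hg : g ∈ setPeriod C) (x : G) : x + g ∈ C ↔ x ∈ C := by
  have h : C + {g} = C := hg
  conv_lhs => rw [← h]
  simp

/-- The splitting of a group into a coset and the offset from the chosen representative. -/
noncomputable def quotientOffsetEquiv {G : Type*} [AddCommGroup G] (H : AddSubgroup G) :
    G ≃ (G ⧸ H) × H where
  toFun g := (g, ⟨g - (g : G ⧸ H).out, by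
    rw [← QuotientAddGroup.eq_iff_sub_mem, QuotientAddGroup.out_eq']⟩)
  invFun p := p.1.out + p.2
  left_inv g := by simp
  right_inv p := by
    have h : ((p.1.out + p.2 : G) : G ⧸ H) = p.1 := by simp
    ext <;> simp

/-- A circulant tournament whose connection set is, off a subgroup `H`, a union of `H`-cosets
is the composition of a digraph on `G ⧸ H` with a digraph on `H`. -/
theorem circulantTournament_isomorphic_composition {m : ℕ} {J : Set (ZMod (2 * m + 1))}
    (H : AddSubgroup (ZMod (2 * m + 1)))
    (hH : ∀ x ∉ H, ∀ h ∈ H, x ∈ J → x + h ∈ J) :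
    DigraphIsomorphic (circulantTournament m J)
      (digraphComposition
        (⟨fun p q : ZMod (2 * m + 1) ⧸ H => p ≠ q ∧ q.out - p.out ∈ J⟩ : Digraph _)
        (⟨fun x y : H => (y : ZMod (2 * m + 1)) - x ∈ J⟩ : Digraph _)) := by
  refine ⟨⟨quotientOffsetEquiv H, ?_⟩⟩
  intro a b
  have ha : a - (a : ZMod (2 * m + 1) ⧸ H).out ∈ H := (quotientOffsetEquiv H a).2.2
  have hb : b - (b : ZMod (2 * m + 1) ⧸ H).out ∈ H := (quotientOffsetEquiv H b).2.2
  simp only [digraphComposition, circulantTournament, quotientOffsetEquiv, Equiv.coe_fn_mk]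
  by_cases hab : (a : ZMod (2 * m + 1) ⧸ H) = b
  · simp [hab]
  · simp only [hab, false_and, false_or, ne_eq, not_false_eq_true, true_and]
    have hd : b - a ∉ H := fun h => hab (QuotientAddGroup.eq_iff_sub_mem.2 h).symm
    set p := (a : ZMod (2 * m + 1) ⧸ H).out
    set q := (b : ZMod (2 * m + 1) ⧸ H).out
    -- `b - a` and `q - p` lie in the same coset, so `hH` applies in both directions.
    have hs : (b - q) - (a - p) ∈ H := H.sub_mem hb ha
    have hd' : q - p ∉ H := fun h => hd (by
      convert H.add_mem h hs using 1
      abel)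
    constructor
    · intro h
      convert hH _ hd' _ hs h using 1
      abel
    · intro h
      convert hH _ hd _ (H.neg_mem hs) h using 1
      abel

theorem IsSymbolSet.isAperiodicSet {m : ℕ} {J : Set (ZMod (2 * m + 1))} (hJ : IsSymbolSet m J) :
    IsAperiodicSet J := by
  refine Set.Subset.antisymm (fun g hg => ?_)
    (Set.singleton_subset_iff.2 (zero_mem_setPeriod J))
  by_contra hg0
  have key : ∀ x, x + g ∈ J ↔ x ∈ J := add_mem_iff_of_mem_setPeriod hg
  rcases hJ.mem_or_neg_mem hg0 with h | h
  · exact hJ.zero_notMem ((key 0).1 (by simpa using h))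
  · exact hJ.zero_notMem (by simpa using (key (-g)).2 h)

theorem IsSymbolSet.zero_notMem_add_self {m : ℕ} {J : Set (ZMod (2 * m + 1))}
    (hJ : IsSymbolSet m J) : (0 : ZMod (2 * m + 1)) ∉ J + J := by
  rintro ⟨a, ha, b, hb, hab⟩
  exact hJ.neg_notMem ha (neg_eq_of_add_eq_zero_right hab ▸ hb)

/-- Translating an element of `J` by a period of `J + J` cannot leave `J`, except to hit `0`. -/
theorem IsSymbolSet.add_mem_of_mem_setPeriod {m : ℕ} {J : Set (ZMod (2 * m + 1))}
    (hJ : IsSymbolSet m J) {x h : ZMod (2 * m + 1)} (hx : x ∈ J) (hh : h ∈ setPeriod (J + J))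
    (hne : x + h ≠ 0) : x + h ∈ J := by
  refine (hJ.mem_or_neg_mem hne).resolve_right fun hneg => hJ.zero_notMem_add_self ?_
  rw [← add_mem_iff_of_mem_setPeriod (neg_mem_setPeriod hh)]
  convert Set.add_mem_add hx hneg using 1
  abel

theorem mainTheorem8 (m : ℕ) (hm : 0 < m) (J : Set (ZMod (2 * m + 1)))
    (hJ : IsSymbolSet m J) (hsimple : IsSimpleDigraph (circulantTournament m J)) :
    IsAperiodicSet J ∧ IsAperiodicSet (J + J) := by
  refine ⟨hJ.isAperiodicSet, ?_⟩
  by_contra hper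
  set H := AddAction.stabilizer (ZMod (2 * m + 1)) (J + J) with hHdef
  have hmem : ∀ g, g ∈ H ↔ g ∈ setPeriod (J + J) := fun g => by
    rw [setPeriod_eq_stabilizer]; rfl
  have hbot : H ≠ ⊥ := fun hb => hper <| by
    rw [IsAperiodicSet, setPeriod_eq_stabilizer, ← hHdef, hb, AddSubgroup.coe_bot]
  have htop : H ≠ ⊤ := by
    intro ht
    obtain ⟨j, hj⟩ : J.Nonempty :=
      Set.nonempty_of_ncard_ne_zero (by rw [hJ.ncard_eq]; exact hm.ne')
    -- This period would carry `j + j` to `0`.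
    have hg : -(j + j) ∈ setPeriod (J + J) := (hmem _).1 (ht ▸ AddSubgroup.mem_top _)
    refine hJ.zero_notMem_add_self ?_
    simpa using (add_mem_iff_of_mem_setPeriod hg (j + j)).2 (Set.add_mem_add hj hj)
  refine hsimple _ _ _ _ (QuotientAddGroup.nontrivial_iff.2 htop)
    ((AddSubgroup.nontrivial_iff_ne_bot H).2 hbot)
    (circulantTournament_isomorphic_composition H fun x hxH h hh hx =>
      hJ.add_mem_of_mem_setPeriod hx ((hmem h).1 hh) fun h0 => hxH ?_)
  -- The exceptional case `x + h = 0` puts `x = -h` inside `H`.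
  rw [eq_neg_of_add_eq_zero_left h0]
  exact H.neg_mem hh
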